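/- Let $S$ be planar simple random walk: $S(0)=0$ and $S(k)=X_1+\dots+X_k$, where the $X_j$ are independent and uniformly distributed on $\{(\pm1,0),(0,\pm1)\}\subset\mathbb Z^2$. Extend $S$ to real times $t\ge 0$ by linear interpolation, regard $\mathbb Z^2$ as a subset of $\mathbb C$, and write $S[0,N]=\{S(t):0\le t\le N\}\subset\mathbb C$. The holes made by $S[0,2n]$ are the connected components of $\mathbb C\setminus S[0,2n]$; the lattice holes made by $S[0,2n]$ are the connected components, with respect to nearest-neighbor paths, of $\mathbb Z^2\setminus\{S(0),\dots,S(2n)\}$. The same terms are used for any deterministic nearest-neighbor path started at $0$. Let $m\ge 0$, and let $H$ be a bounded set that is, up to translation by an element of $\mathbb Z^2$, a hole (respectively a lattice hole) made by some nearest-neighbor path of $2m$ steps started at $0$. (This forces $m\ge2$.) Let $$N_H=N_H(n)=\#\{z\in\mathbb Z^2 : H+z \text{ is a hole (respectively a lattice hole) made by } S[0,2n]\}.$$ Then there is a constant $K>0$, not depending on $n$ or on the probability space on which $S$ is defined, such that for all $n\ge m$, $$\mathbb E[N_H]\ \ge\ K\,\frac{n}{\log^2 n}.$$ -/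

import Mathlib

open MeasureTheory ProbabilityTheory
open scoped ENNReal

namespace PlanarHoles

/-- The four nearest-neighbour steps `±e₁, ±e₂` of the square lattice `ℤ²`. -/
def unitSteps : Finset (ℤ × ℤ) := {(1, 0), (-1, 0), (0, 1), (0, -1)}

/-- The nearest-neighbour graph on `ℤ²`. -/
def latticeGraph : SimpleGraph (ℤ × ℤ) := SimpleGraph.fromRel fun z w => w - z ∈ unitSteps

/-- The lattice point `z = (a, b)` viewed as the complex number `a + b i`. -/
noncomputable def toComplex (z : ℤ × ℤ) : ℂ := ⟨(z.1 : ℝ), (z.2 : ℝ)⟩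

/-- The lattice path with increments `x 0, x 1, …`, started at the origin: its position at
time `k` is the sum of the first `k` increments. -/
def path (x : ℕ → ℤ × ℤ) (k : ℕ) : ℤ × ℤ := ∑ j ∈ Finset.range k, x j

/-- The linear interpolation `S(t) = S([t]) + (t - [t]) (S([t] + 1) - S([t]))` for real `t ≥ 0`. -/
noncomputable def interp (s : ℕ → ℤ × ℤ) (t : ℝ) : ℂ :=
  toComplex (s ⌊t⌋₊) +
    ((t - ⌊t⌋₊ : ℝ) : ℂ) * (toComplex (s (⌊t⌋₊ + 1)) - toComplex (s ⌊t⌋₊))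

/-- `S[0, N] = {S(t) : 0 ≤ t ≤ N}`, a subset of the complex plane. -/
def trace (s : ℕ → ℤ × ℤ) (N : ℕ) : Set ℂ := interp s '' Set.Icc (0 : ℝ) N

/-- `{S(j) : j = 0, …, N}`, a subset of `ℤ²`. -/
def latticeTrace (s : ℕ → ℤ × ℤ) (N : ℕ) : Set (ℤ × ℤ) := {z | ∃ j ≤ N, s j = z}

/-- `H` is a hole made by `S[0, N]`: a connected component of `ℂ \ S[0, N]`. -/
def IsHole (s : ℕ → ℤ × ℤ) (N : ℕ) (H : Set ℂ) : Prop :=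
  ∃ w ∈ (trace s N)ᶜ, H = connectedComponentIn (trace s N)ᶜ w

/-- `H` is a lattice hole made by `S[0, N]`: the set of all points that can be joined to some
given point of `ℤ² \ {S(0), …, S(N)}` by a nearest-neighbour path avoiding `{S(0), …, S(N)}`. -/
def IsLatticeHole (s : ℕ → ℤ × ℤ) (N : ℕ) (H : Set (ℤ × ℤ)) : Prop :=
  ∃ w ∉ latticeTrace s N,
    H = {v | ∃ p : latticeGraph.Walk w v, ∀ u ∈ p.support, u ∉ latticeTrace s N}

/-- The translate `H_z = H + z` of a plane set by a lattice point. -/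
def translate (H : Set ℂ) (z : ℤ × ℤ) : Set ℂ := (fun w => w + toComplex z) '' H

/-- The translate `H_z = H + z` of a lattice set by a lattice point. -/
def latticeTranslate (H : Set (ℤ × ℤ)) (z : ℤ × ℤ) : Set (ℤ × ℤ) := (fun w => w + z) '' H

/-- The bounded plane sets that are, up to a translation by a lattice point, a hole of some
nearest-neighbour path from the origin of time duration `2 n`. -/
def holeShapes (n : ℕ) : Set (Set ℂ) :=
  {H | Bornology.IsBounded H ∧
    ∃ x : ℕ → ℤ × ℤ, (∀ j, x j ∈ unitSteps) ∧ ∃ z, IsHole (path x) (2 * n) (translate H z)}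

/-- The finite lattice sets that are, up to a translation, a lattice hole of some
nearest-neighbour path from the origin of time duration `2 n`. -/
def latticeHoleShapes (n : ℕ) : Set (Set (ℤ × ℤ)) :=
  {H | H.Finite ∧
    ∃ x : ℕ → ℤ × ℤ, (∀ j, x j ∈ unitSteps) ∧
      ∃ z, IsLatticeHole (path x) (2 * n) (latticeTranslate H z)}

/-- `X 0, X 1, …` are the increments of a planar simple random walk: they are independent and
each of them is uniformly distributed on `{±e₁, ±e₂}`. -/
structure IsSRWIncrements {Ω : Type*} [MeasurableSpace Ω] (P : Measure Ω)
    (X : ℕ → Ω → ℤ × ℤ) : Prop where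
  measurable : ∀ j, Measurable (X j)
  indep : iIndepFun X P
  law : ∀ j, ∀ e ∈ unitSteps, P {ω | X j ω = e} = 1 / 4

/-- `N_H`, the number of `z ∈ ℤ²` such that `H + z` is a hole made by `S[0, 2n]`. -/
noncomputable def holeCount (s : ℕ → ℤ × ℤ) (n : ℕ) (H : Set ℂ) : ℕ∞ :=
  {z : ℤ × ℤ | IsHole s (2 * n) (translate H z)}.encard

/-- `N_H`, the number of `z ∈ ℤ²` such that `H + z` is a lattice hole made by `S[0, 2n]`. -/
noncomputable def latticeHoleCount (s : ℕ → ℤ × ℤ) (n : ℕ) (H : Set (ℤ × ℤ)) : ℕ∞ :=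
  {z : ℤ × ℤ | IsLatticeHole s (2 * n) (latticeTranslate H z)}.encard

end PlanarHoles

/-!
The expected number of copies of a given hole is bounded from below by counting words of steps:
the walk follows a given word of `N` steps with probability `4⁻ᴺ`.

Let `γ` be a path of `2 m` steps that makes the hole `G`, and let `B` be the finite set of lattice
points with an incident edge that meets `G`, together with the origin. If the walk follows `γ` from
a point `z` and never uses an edge that meets `G + z`, then `G + z` is a hole of the walk
(`isHole_translate`, `isLatticeHole_translate`). To produce this event with a given time `k`, let
the walk reach `z + b`, `b ∈ B`, for the first time it visits `z + B` at time `k`, then run along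
`γ` and back to `z + b` on a fixed loop that does not meet the hole, and then avoid `z + B`. The
past, read backwards, and the future are words from `b` that avoid `B`; so, with `ℓ` the length of
the loop, this has probability at least `4⁻ˡ q²`, where `q` is the probability that the walk from
`b` avoids `B` for `2 n` steps. Different `k` give different `z`, because `k` is the first hitting
time of `z + B`, and summing over `k` gives `(2 n - ℓ) 4⁻ˡ q²` (`le_lintegral_followsAt`).

It remains to see that `q ≥ c / log n` for some `b ∈ B`, which may depend on `n`
(`exists_le_avoidProb`). By `last_exit`, the probabilities of the last visits to `B` of a walk that
starts in `B` add up to one. In `2 |B| M + M` steps, the last visits in the final `M` steps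
contribute at most `1 / 2`, since `P(S(j) = y) ≤ 1 / (j + 1)` (`heatKernel_le`), and the others
contribute at most the harmonic sum of order `log M` times the sum over `b ∈ B` of the
probabilities to avoid `B` for `M` steps.

Finally, the loop exists because a lattice point outside the hole can be joined to the path `γ`
without meeting the hole: walk towards the origin, which `γ` visits, until `γ` is met
(`exists_okWord_to_zero`). Both kinds of holes are treated at once through a relation `ok` on pairs
of neighbours, which says that the edge does not meet the hole.
-/

namespace PlanarHoles

/-! ### The heat kernel -/

theorem sum_unitSteps {M : Type*} [AddCommMonoid M] (f : ℤ × ℤ → M) :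
    ∑ e ∈ unitSteps, f e = f (1, 0) + (f (-1, 0) + (f (0, 1) + f (0, -1))) := by
  rw [unitSteps, Finset.sum_insert (by decide), Finset.sum_insert (by decide),
    Finset.sum_insert (by decide), Finset.sum_singleton]

theorem card_unitSteps : unitSteps.card = 4 := by decide

theorem neg_mem_unitSteps {e : ℤ × ℤ} (he : e ∈ unitSteps) : -e ∈ unitSteps := by
  revert e; decide

/-- The probability that one-dimensional simple random walk is at `u` after `j` steps. -/
noncomputable def lineKernel : ℕ → ℤ → ℝ
  | 0, u => if u = 0 then 1 else 0
  | j + 1, u => (lineKernel j (u - 1) + lineKernel j (u + 1)) / 2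

/-- The probability that planar simple random walk is displaced by `-y` after `j` steps. -/
noncomputable def heatKernel : ℕ → ℤ × ℤ → ℝ
  | 0, y => if y = 0 then 1 else 0
  | j + 1, y => (∑ e ∈ unitSteps, heatKernel j (y + e)) / 4

/-- In the coordinates `y₁ + y₂`, `y₁ - y₂` the planar walk is a pair of independent
one-dimensional walks. -/
theorem heatKernel_eq (j : ℕ) (y : ℤ × ℤ) :
    heatKernel j y = lineKernel j (y.1 + y.2) * lineKernel j (y.1 - y.2) := by
  induction j generalizing y with
  | zero =>
    obtain ⟨a, b⟩ := y
    simp only [heatKernel, lineKernel, Prod.mk_eq_zero]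
    split_ifs <;> first | omega | norm_num
  | succ j ih =>
    obtain ⟨a, b⟩ := y
    simp only [heatKernel, lineKernel, sum_unitSteps, ih, Prod.mk_add_mk]
    rw [show a + 1 + (b + 0) = a + b + 1 by ring, show a + 1 - (b + 0) = a - b + 1 by ring,
      show a + -1 + (b + 0) = a + b - 1 by ring, show a + -1 - (b + 0) = a - b - 1 by ring,
      show a + 0 + (b + 1) = a + b + 1 by ring, show a + 0 - (b + 1) = a - b - 1 by ring,
      show a + 0 + (b + -1) = a + b - 1 by ring, show a + 0 - (b + -1) = a - b + 1 by ring]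
    ring

theorem lineKernel_eq_choose (j i : ℕ) :
    lineKernel j (2 * i - j) = (j.choose i : ℝ) / 2 ^ j := by
  have neg : ∀ (j : ℕ) (u : ℤ), u + j < 0 → lineKernel j u = 0 := by
    intro j
    induction j with
    | zero => intro u hu; simp only [lineKernel]; rw [if_neg (by omega)]
    | succ j ih =>
      intro u hu
      push_cast at hu
      simp [lineKernel, ih (u - 1) (by omega), ih (u + 1) (by omega)]
  induction j generalizing i with
  | zero => cases i <;> simp [lineKernel]; omega
  | succ j ih =>
    cases i with
    | zero =>
      have h := ih 0
      simp only [lineKernel]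
      rw [neg j _ (by push_cast; omega),
        show (2 * ((0 : ℕ) : ℤ) - ((j + 1 : ℕ) : ℤ) + 1) = 2 * ((0 : ℕ) : ℤ) - j by push_cast; ring,
        h]
      simp [pow_succ]; field_simp
    | succ i =>
      simp only [lineKernel]
      rw [show (2 * ((i + 1 : ℕ) : ℤ) - ((j + 1 : ℕ) : ℤ) - 1) = 2 * (i : ℤ) - j by push_cast; ring,
        show (2 * ((i + 1 : ℕ) : ℤ) - ((j + 1 : ℕ) : ℤ) + 1) = 2 * ((i + 1 : ℕ) : ℤ) - j by
          push_cast; ring, ih, ih, Nat.choose_succ_succ, pow_succ]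
      push_cast; field_simp

theorem lineKernel_eq_zero_or (j : ℕ) (u : ℤ) :
    lineKernel j u = 0 ∨ ∃ i : ℕ, u = 2 * i - j := by
  induction j generalizing u with
  | zero =>
    by_cases hu : u = 0
    · exact Or.inr ⟨0, by simp [hu]⟩
    · exact Or.inl (by simp [lineKernel, hu])
  | succ j ih =>
    rcases ih (u - 1) with h1 | ⟨i, hi⟩
    · rcases ih (u + 1) with h2 | ⟨i, hi⟩
      · exact Or.inl (by simp [lineKernel, h1, h2])
      · exact Or.inr ⟨i, by push_cast; omega⟩
    · exact Or.inr ⟨i + 1, by push_cast; omega⟩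

theorem centralBinom_sq_mul_le (n : ℕ) : n.centralBinom ^ 2 * (2 * n + 1) ≤ 16 ^ n := by
  induction n with
  | zero => simp
  | succ n ih =>
    have h := Nat.succ_mul_centralBinom_succ n
    refine Nat.le_of_mul_le_mul_left ?_ (show 0 < (n + 1) ^ 2 by positivity)
    calc (n + 1) ^ 2 * ((n + 1).centralBinom ^ 2 * (2 * (n + 1) + 1))
        = ((n + 1) * (n + 1).centralBinom) ^ 2 * (2 * n + 3) := by ring
      _ = (n.centralBinom ^ 2 * (2 * n + 1)) * (4 * ((2 * n + 1) * (2 * n + 3))) := by rw [h]; ring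
      _ ≤ 16 ^ n * (4 * (4 * (n + 1) ^ 2)) := by
        refine Nat.mul_le_mul ih (Nat.mul_le_mul_left _ ?_)
        nlinarith
      _ = (n + 1) ^ 2 * 16 ^ (n + 1) := by ring

theorem choose_sq_mul_le (j i : ℕ) : j.choose i ^ 2 * (j + 1) ≤ 4 ^ j := by
  refine (Nat.mul_le_mul_right _ (Nat.pow_le_pow_left (Nat.choose_le_middle i j) 2)).trans ?_
  rcases Nat.even_or_odd' j with ⟨n, rfl | rfl⟩
  · have h := centralBinom_sq_mul_le n
    rw [Nat.mul_div_cancel_left _ two_pos, pow_mul]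
    exact h
  · have h := centralBinom_sq_mul_le (n + 1)
    -- `(2n+2 choose n+1) = 2 (2n+1 choose n)`
    have h2 : (n + 1).centralBinom = 2 * (2 * n + 1).choose n := by
      have : (n + 1).centralBinom = (2 * n + 1 + 1).choose (n + 1) := rfl
      rw [this, Nat.choose_succ_succ, Nat.choose_symm_half]; ring
    rw [show (2 * n + 1) / 2 = n by omega]
    have e : (16 : ℕ) ^ (n + 1) = 4 * 4 ^ (2 * n + 1) := by
      rw [show (16 : ℕ) = 4 ^ 2 by norm_num, ← pow_mul, ← pow_succ']; ring_nf
    rw [h2, e] at h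
    nlinarith [Nat.zero_le ((2 * n + 1).choose n ^ 2)]

theorem lineKernel_sq_le (j : ℕ) (u : ℤ) : lineKernel j u ^ 2 ≤ 1 / (j + 1) := by
  rcases lineKernel_eq_zero_or j u with h | ⟨i, rfl⟩
  · rw [h, zero_pow two_ne_zero]; positivity
  · rw [lineKernel_eq_choose, div_pow, div_le_div_iff₀ (by positivity) (by positivity), one_mul,
      ← pow_mul, mul_comm j 2, pow_mul]
    have := choose_sq_mul_le j i
    norm_num
    exact_mod_cast this

theorem heatKernel_le (j : ℕ) (y : ℤ × ℤ) : heatKernel j y ≤ 1 / (j + 1) := by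
  rw [heatKernel_eq]
  nlinarith [lineKernel_sq_le j (y.1 + y.2), lineKernel_sq_le j (y.1 - y.2),
    sq_nonneg (lineKernel j (y.1 + y.2) - lineKernel j (y.1 - y.2))]

/-! ### Avoiding a finite set -/

/-- The probability that simple random walk started at `a` is outside `B` at the times
`1, …, M`; the starting point itself may be in `B`. -/
noncomputable def avoidProb (B : Finset (ℤ × ℤ)) : ℕ → ℤ × ℤ → ℝ
  | 0, _ => 1
  | M + 1, a => (∑ e ∈ unitSteps, if a + e ∈ B then 0 else avoidProb B M (a + e)) / 4

theorem avoidProb_nonneg (B : Finset (ℤ × ℤ)) (M : ℕ) (a : ℤ × ℤ) : 0 ≤ avoidProb B M a := by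
  induction M generalizing a with
  | zero => simp [avoidProb]
  | succ M ih =>
    refine div_nonneg (Finset.sum_nonneg fun e _ => ?_) (by norm_num)
    split_ifs
    exacts [le_rfl, ih _]

theorem avoidProb_le_one (B : Finset (ℤ × ℤ)) (M : ℕ) (a : ℤ × ℤ) : avoidProb B M a ≤ 1 := by
  induction M generalizing a with
  | zero => simp [avoidProb]
  | succ M ih =>
    have : (∑ e ∈ unitSteps, if a + e ∈ B then 0 else avoidProb B M (a + e)) ≤
        ∑ e ∈ unitSteps, (1 : ℝ) :=
      Finset.sum_le_sum fun e _ => by split_ifs; exacts [zero_le_one, ih _]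
    simp only [Finset.sum_const, card_unitSteps] at this
    simp only [avoidProb]
    norm_num at this ⊢
    linarith

theorem avoidProb_antitone (B : Finset (ℤ × ℤ)) (a : ℤ × ℤ) :
    Antitone fun M => avoidProb B M a := by
  refine antitone_nat_of_succ_le fun M => ?_
  induction M generalizing a with
  | zero => exact avoidProb_le_one B 1 a
  | succ M ih =>
    rw [avoidProb, avoidProb]
    gcongr with e _
    split_ifs
    exacts [le_rfl, ih _]

/-- The last exit decomposition: the walk started at `x` either avoids `B` during `[0, N]`, or
has a last visit to `B`, at some point `b` and at some time `j`. -/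
theorem last_exit (B : Finset (ℤ × ℤ)) (N : ℕ) (x : ℤ × ℤ) :
    ∑ j ∈ Finset.range (N + 1), ∑ b ∈ B, heatKernel j (x - b) * avoidProb B (N - j) b =
      1 - if x ∈ B then 0 else avoidProb B N x := by
  have zero_term (N : ℕ) (x : ℤ × ℤ) :
      ∑ b ∈ B, heatKernel 0 (x - b) * avoidProb B N b = if x ∈ B then avoidProb B N x else 0 := by
    simp [heatKernel, sub_eq_zero]
  induction N generalizing x with
  | zero => rw [Finset.sum_range_one, zero_term]; split_ifs <;> simp [avoidProb]
  | succ N ih =>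
    rw [Finset.sum_range_succ']
    have hs : ∑ j ∈ Finset.range (N + 1), ∑ b ∈ B,
          heatKernel (j + 1) (x - b) * avoidProb B (N + 1 - (j + 1)) b =
        (∑ e ∈ unitSteps, ∑ j ∈ Finset.range (N + 1), ∑ b ∈ B,
          heatKernel j (x + e - b) * avoidProb B (N - j) b) / 4 := by
      rw [Finset.sum_comm (s := unitSteps), Finset.sum_div]
      refine Finset.sum_congr rfl fun j _ => ?_
      rw [Finset.sum_comm (s := unitSteps), Finset.sum_div]
      refine Finset.sum_congr rfl fun b _ => ?_
      rw [← Finset.sum_mul, heatKernel, Nat.add_sub_add_right]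
      simp only [sub_add_eq_add_sub]
      ring
    have ha : (∑ e ∈ unitSteps, (1 - if x + e ∈ B then 0 else avoidProb B N (x + e))) / 4 =
        1 - avoidProb B (N + 1) x := by
      rw [Finset.sum_sub_distrib, avoidProb]
      simp only [Finset.sum_const, card_unitSteps]
      norm_num
      ring
    rw [hs, Nat.sub_zero, zero_term]
    simp only [ih]
    rw [ha]
    split_ifs <;> ring

/-- Among the points of a nonempty finite set there is one from which the walk avoids the set
for `M` steps with probability of order at least `1 / log M`. -/
theorem exists_le_avoidProb {B : Finset (ℤ × ℤ)} (hB : B.Nonempty) {M : ℕ} (hM : 1 ≤ M) :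
    ∃ b ∈ B, 1 / (2 * B.card * (1 + Real.log (2 * B.card * M + 1))) ≤ avoidProb B M b := by
  obtain ⟨x, hx⟩ := hB
  set s := B.card with hs
  have hs0 : 1 ≤ s := Finset.card_pos.2 ⟨x, hx⟩
  -- A walk of `2 s M + M` steps from `x`: the last visit to `B` falls in the final `M` steps with
  -- probability at most `1 / 2`, and if it falls before, then `B` is avoided for `M` steps.
  have h := last_exit B (2 * s * M + M) x
  rw [if_pos hx, sub_zero, show 2 * s * M + M + 1 = (2 * s * M + 1) + M by ring,
    Finset.sum_range_add] at h
  have h1 : ∑ j ∈ Finset.range (2 * s * M + 1), ∑ b ∈ B,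
      heatKernel j (x - b) * avoidProb B (2 * s * M + M - j) b ≤
      (1 + Real.log (2 * s * M + 1)) * ∑ b ∈ B, avoidProb B M b := by
    have hh := harmonic_le_one_add_log (2 * s * M + 1)
    rw [harmonic] at hh
    push_cast at hh
    refine le_trans ?_ (mul_le_mul_of_nonneg_right hh
      (Finset.sum_nonneg fun b _ => avoidProb_nonneg B M b))
    rw [Finset.sum_mul]
    refine Finset.sum_le_sum fun j hj => ?_
    rw [Finset.mul_sum]
    refine Finset.sum_le_sum fun b _ => ?_
    have := heatKernel_le j (x - b)
    rw [one_div] at this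
    refine mul_le_mul this (avoidProb_antitone B b ?_) (avoidProb_nonneg _ _ _) (by positivity)
    have := Finset.mem_range.1 hj
    omega
  have h2 : ∑ i ∈ Finset.range M, ∑ b ∈ B,
      heatKernel (2 * s * M + 1 + i) (x - b) *
        avoidProb B (2 * s * M + M - (2 * s * M + 1 + i)) b ≤ 1 / 2 := by
    have hsM : (0 : ℝ) < 2 * s * M := by positivity
    calc _ ≤ ∑ i ∈ Finset.range M, ∑ b ∈ B, 1 / (2 * s * M : ℝ) := by
          refine Finset.sum_le_sum fun i _ => Finset.sum_le_sum fun b _ => ?_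
          rw [← mul_one (1 / (2 * s * M : ℝ))]
          refine mul_le_mul ((heatKernel_le _ _).trans ?_) (avoidProb_le_one _ _ _)
            (avoidProb_nonneg _ _ _) (by positivity)
          refine one_div_le_one_div_of_le hsM ?_
          push_cast
          have : (0 : ℝ) ≤ i := by positivity
          linarith
      _ = 1 / 2 := by
          simp only [Finset.sum_const, Finset.card_range, nsmul_eq_mul, ← hs]
          field_simp
  by_contra! hc
  have hL : 0 ≤ Real.log (2 * s * M + 1) := Real.log_nonneg (by
    have : (0 : ℝ) ≤ 2 * s * M := by positivity
    linarith)
  have h3 : ∑ b ∈ B, avoidProb B M b <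
      ∑ b ∈ B, 1 / (2 * s * (1 + Real.log (2 * s * M + 1))) :=
    Finset.sum_lt_sum_of_nonempty ⟨x, hx⟩ hc
  rw [Finset.sum_const, ← hs, nsmul_eq_mul] at h3
  have h4 := mul_lt_mul_of_pos_left h3 (show 0 < 1 + Real.log (2 * s * M + 1) by linarith)
  have h5 : (1 + Real.log (2 * s * M + 1)) * (s * (1 / (2 * s * (1 + Real.log (2 * s * M + 1)))))
      = 1 / 2 := by
    have : (s : ℝ) ≠ 0 := by positivity
    have : 1 + Real.log (2 * s * M + 1) ≠ 0 := by positivity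
    field_simp
  linarith

/-! ### Words of steps -/

/-- All edges `(a, a + e)` traversed by the lattice path that starts at `a` and follows the word
of steps `w` satisfy the relation `ok`. -/
def OkWord (ok : ℤ × ℤ → ℤ × ℤ → Prop) : ℤ × ℤ → List (ℤ × ℤ) → Prop
  | _, [] => True
  | a, e :: w => ok a (a + e) ∧ OkWord ok (a + e) w

/-- The word of steps of the reversed path. -/
def revWord (w : List (ℤ × ℤ)) : List (ℤ × ℤ) := (w.map Neg.neg).reverse

theorem revWord_cons (e : ℤ × ℤ) (w : List (ℤ × ℤ)) : revWord (e :: w) = revWord w ++ [-e] := by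
  simp [revWord]

theorem revWord_length (w : List (ℤ × ℤ)) : (revWord w).length = w.length := by
  simp [revWord]

theorem revWord_sum (w : List (ℤ × ℤ)) : (revWord w).sum = -w.sum := by
  induction w with
  | nil => simp [revWord]
  | cons e w ih => rw [revWord_cons, List.sum_append, ih]; simp [add_comm]

theorem revWord_injective : Function.Injective revWord :=
  List.reverse_injective.comp (List.map_injective_iff.2 neg_injective)

theorem mem_unitSteps_of_mem_revWord {w : List (ℤ × ℤ)} (hw : ∀ e ∈ w, e ∈ unitSteps) :
    ∀ e ∈ revWord w, e ∈ unitSteps := by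
  intro e he
  simp only [revWord, List.mem_reverse, List.mem_map] at he
  obtain ⟨f, hf, rfl⟩ := he
  exact neg_mem_unitSteps (hw f hf)

theorem revWord_take_sum (w : List (ℤ × ℤ)) (i : ℕ) :
    w.sum + ((revWord w).take i).sum = (w.take (w.length - i)).sum := by
  have h1 : (revWord w).take i = revWord (w.drop (w.length - i)) := by
    simp [revWord, List.take_reverse, List.map_drop]
  rw [h1, revWord_sum]
  nth_rw 1 [← List.take_append_drop (w.length - i) w]
  rw [List.sum_append]
  abel

section OkWord

variable {ok : ℤ × ℤ → ℤ × ℤ → Prop}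

theorem okWord_append (a : ℤ × ℤ) (w₁ w₂ : List (ℤ × ℤ)) :
    OkWord ok a (w₁ ++ w₂) ↔ OkWord ok a w₁ ∧ OkWord ok (a + w₁.sum) w₂ := by
  induction w₁ generalizing a with
  | nil => simp [OkWord]
  | cons e w ih => simp [OkWord, ih, and_assoc, add_assoc]

theorem okWord_revWord (hsymm : ∀ a b, ok a b → ok b a) {a : ℤ × ℤ} {w : List (ℤ × ℤ)}
    (h : OkWord ok a w) : OkWord ok (a + w.sum) (revWord w) := by
  induction w generalizing a with
  | nil => trivial
  | cons e w ih =>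
    rw [revWord_cons, okWord_append, List.sum_cons, ← add_assoc, revWord_sum, add_neg_cancel_right]
    refine ⟨ih h.2, ?_, trivial⟩
    rw [add_neg_cancel_right]
    exact hsymm _ _ h.1

theorem OkWord.take {a : ℤ × ℤ} {w : List (ℤ × ℤ)} (h : OkWord ok a w) (i : ℕ) :
    OkWord ok a (w.take i) := by
  rw [← List.take_append_drop i w, okWord_append] at h
  exact h.1

theorem OkWord.ok_take {a : ℤ × ℤ} {w : List (ℤ × ℤ)} (h : OkWord ok a w) {i : ℕ}
    (hi : i < w.length) : ok (a + (w.take i).sum) (a + (w.take (i + 1)).sum) := by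
  induction w generalizing a i with
  | nil => simp at hi
  | cons e w ih =>
    cases i with
    | zero => simpa using h.1
    | succ i =>
      have := ih h.2 (Nat.lt_of_succ_lt_succ hi)
      simpa [add_assoc] using this

end OkWord

/-- The words of `M` unit steps such that the path that starts at `a` and follows the word is
outside `B` at the times `1, …, M`. -/
def avoidWords (B : Finset (ℤ × ℤ)) : ℕ → ℤ × ℤ → Finset (List (ℤ × ℤ))
  | 0, _ => {[]}
  | M + 1, a => (unitSteps.filter fun e => a + e ∉ B).biUnion fun e =>
      (avoidWords B M (a + e)).map ⟨List.cons e, List.cons_injective⟩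

theorem mem_avoidWords_succ {B : Finset (ℤ × ℤ)} {M : ℕ} {a : ℤ × ℤ} {w : List (ℤ × ℤ)} :
    w ∈ avoidWords B (M + 1) a ↔
      ∃ e ∈ unitSteps, a + e ∉ B ∧ ∃ v ∈ avoidWords B M (a + e), e :: v = w := by
  simp [avoidWords, and_assoc]

theorem card_avoidWords (B : Finset (ℤ × ℤ)) (M : ℕ) (a : ℤ × ℤ) :
    ((avoidWords B M a).card : ℝ) = 4 ^ M * avoidProb B M a := by
  induction M generalizing a with
  | zero => simp [avoidWords, avoidProb]
  | succ M ih =>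
    rw [avoidWords, Finset.card_biUnion]
    · push_cast
      simp only [Finset.card_map, ih, avoidProb]
      rw [Finset.sum_filter, mul_div_assoc', pow_succ, mul_right_comm,
        mul_div_cancel_right₀ _ (by norm_num), Finset.mul_sum]
      refine Finset.sum_congr rfl fun e _ => ?_
      by_cases h : a + e ∈ B <;> simp [h]
    · intro e _ f _ hef
      rw [Function.onFun, Finset.disjoint_left]
      intro w hw hw'
      simp only [Finset.mem_map, Function.Embedding.coeFn_mk] at hw hw'
      obtain ⟨v, _, rfl⟩ := hw
      obtain ⟨v', _, h⟩ := hw'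
      exact hef (List.cons.inj h).1.symm

section avoidWords

variable {B : Finset (ℤ × ℤ)} {M : ℕ} {a : ℤ × ℤ} {w : List (ℤ × ℤ)}

theorem length_of_mem_avoidWords (h : w ∈ avoidWords B M a) : w.length = M := by
  induction M generalizing a w with
  | zero => simp_all [avoidWords]
  | succ M ih =>
    obtain ⟨e, _, _, v, hv, rfl⟩ := mem_avoidWords_succ.1 h
    simp [ih hv]

theorem mem_unitSteps_of_mem_avoidWords (h : w ∈ avoidWords B M a) : ∀ e ∈ w, e ∈ unitSteps := by
  induction M generalizing a w with
  | zero => simp_all [avoidWords]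
  | succ M ih =>
    obtain ⟨e, he, _, v, hv, rfl⟩ := mem_avoidWords_succ.1 h
    simpa [he] using ih hv

theorem take_sum_notMem_of_mem_avoidWords (h : w ∈ avoidWords B M a) {i : ℕ} (hi : 0 < i)
    (hiM : i ≤ M) : a + (w.take i).sum ∉ B := by
  induction M generalizing a w i with
  | zero => omega
  | succ M ih =>
    obtain ⟨e, he, hB, v, hv, rfl⟩ := mem_avoidWords_succ.1 h
    obtain ⟨i, rfl⟩ := Nat.exists_eq_succ_of_ne_zero hi.ne'
    rcases Nat.eq_zero_or_pos i with rfl | hi'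
    · simpa using hB
    · simpa [add_assoc] using ih hv hi' (by omega)

theorem okWord_of_mem_avoidWords {ok : ℤ × ℤ → ℤ × ℤ → Prop}
    (hok : ∀ a, ∀ e ∈ unitSteps, a + e ∉ B → ok a (a + e)) (h : w ∈ avoidWords B M a) :
    OkWord ok a w := by
  induction M generalizing a w with
  | zero => simp_all [avoidWords, OkWord]
  | succ M ih =>
    obtain ⟨e, he, hB, v, hv, rfl⟩ := mem_avoidWords_succ.1 h
    exact ⟨hok a e he hB, ih hv⟩

end avoidWords

theorem exists_notMem_of_avoidProb_pos {B : Finset (ℤ × ℤ)} {M : ℕ} {b : ℤ × ℤ} (hM : 1 ≤ M)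
    (h : 0 < avoidProb B M b) : ∃ e ∈ unitSteps, b + e ∉ B := by
  by_contra! hc
  obtain ⟨M, rfl⟩ := Nat.exists_eq_succ_of_ne_zero (Nat.one_le_iff_ne_zero.1 hM)
  rw [avoidProb, Finset.sum_congr rfl fun e he => if_pos (hc e he)] at h
  simp at h

/-! ### The walk following a given word -/

theorem path_eq_take_sum (x : ℕ → ℤ × ℤ) {i N : ℕ} (hi : i ≤ N) :
    path x i = (((List.range N).map x).take i).sum := by
  rw [← List.map_take, List.take_range, min_eq_left hi, path]
  clear hi
  induction i with
  | zero => simp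
  | succ i ih => rw [Finset.sum_range_succ, ih, List.range_succ]; simp

theorem map_range_eq_iff {N : ℕ} {W : List (ℤ × ℤ)} (hN : W.length = N) (x : ℕ → ℤ × ℤ) :
    (List.range N).map x = W ↔ ∀ i ∈ Finset.range N, x i = W.getD i 0 := by
  constructor
  · rintro rfl i hi
    rw [Finset.mem_range] at hi
    simp [hi]
  · intro h
    refine List.ext_getElem (by simp [hN]) fun i h1 h2 => ?_
    have := h i (Finset.mem_range.2 (hN ▸ h2))
    simpa [h2] using this

theorem setOf_map_range_eq {Ω : Type*} {X : ℕ → Ω → ℤ × ℤ} {N : ℕ} {W : List (ℤ × ℤ)}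
    (hN : W.length = N) :
    {ω | (List.range N).map (fun j => X j ω) = W} =
      ⋂ i ∈ Finset.range N, X i ⁻¹' {W.getD i 0} := by
  ext ω
  simp only [Set.mem_ofPred_eq, map_range_eq_iff hN, Set.mem_iInter, Set.mem_preimage,
    Set.mem_singleton_iff]

section Probability

variable {Ω : Type*} [MeasurableSpace Ω] {P : Measure Ω} {X : ℕ → Ω → ℤ × ℤ}

theorem measurableSet_map_range_eq (hX : IsSRWIncrements P X) {N : ℕ} {W : List (ℤ × ℤ)}
    (hN : W.length = N) : MeasurableSet {ω | (List.range N).map (fun j => X j ω) = W} := by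
  rw [setOf_map_range_eq hN]
  exact Finset.measurableSet_biInter _ fun i _ => hX.measurable i (measurableSet_singleton _)

theorem measure_map_range_eq (hX : IsSRWIncrements P X) {N : ℕ} {W : List (ℤ × ℤ)}
    (hN : W.length = N) (hW : ∀ e ∈ W, e ∈ unitSteps) :
    P {ω | (List.range N).map (fun j => X j ω) = W} = (1 / 4) ^ N := by
  rw [setOf_map_range_eq hN, hX.indep.measure_inter_preimage_eq_mul (Finset.range N)
    (sets := fun i => {W.getD i 0}) fun i _ => measurableSet_singleton _]
  rw [Finset.prod_congr rfl (g := fun _ => (1 / 4 : ℝ≥0∞)), Finset.prod_const, Finset.card_range]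
  intro i hi
  refine hX.law i _ (hW _ ?_)
  have : i < W.length := hN ▸ Finset.mem_range.1 hi
  rw [List.getD_eq_getElem _ _ this]
  exact List.getElem_mem this

theorem measurableSet_map_range_mem (hX : IsSRWIncrements P X) {N : ℕ}
    {A : Finset (List (ℤ × ℤ))} (hN : ∀ W ∈ A, W.length = N) :
    MeasurableSet {ω | (List.range N).map (fun j => X j ω) ∈ A} := by
  rw [show {ω | (List.range N).map (fun j => X j ω) ∈ A} =
    ⋃ W ∈ A, {ω | (List.range N).map (fun j => X j ω) = W} by ext ω; simp]
  exact Finset.measurableSet_biUnion _ fun W hW => measurableSet_map_range_eq hX (hN W hW)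

theorem measure_map_range_mem (hX : IsSRWIncrements P X) {N : ℕ} {A : Finset (List (ℤ × ℤ))}
    (hN : ∀ W ∈ A, W.length = N) (hA : ∀ W ∈ A, ∀ e ∈ W, e ∈ unitSteps) :
    P {ω | (List.range N).map (fun j => X j ω) ∈ A} = A.card * (1 / 4) ^ N := by
  rw [show {ω | (List.range N).map (fun j => X j ω) ∈ A} =
    ⋃ W ∈ A, {ω | (List.range N).map (fun j => X j ω) = W} by ext ω; simp,
    measure_biUnion_finset]
  · rw [Finset.sum_congr rfl fun W hW => measure_map_range_eq hX (hN W hW) (hA W hW)]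
    simp
  · intro W _ W' _ hne
    exact Set.disjoint_left.2 fun ω h h' => hne (h.symm.trans h')
  · exact fun W hW => measurableSet_map_range_eq hX (hN W hW)

end Probability

/-! ### The expected number of undisturbed copies of a finite path -/

/-- Up to time `N`, and seen from the point `z`, the lattice path `s` traverses only edges that
satisfy `ok`, and at some time it starts from `z` to follow the word `γ`. -/
def FollowsAt (ok : ℤ × ℤ → ℤ × ℤ → Prop) (γ : List (ℤ × ℤ)) (s : ℕ → ℤ × ℤ) (N : ℕ)
    (z : ℤ × ℤ) : Prop :=
  (∀ i < N, ok (s i - z) (s (i + 1) - z)) ∧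
    ∃ k, k + γ.length ≤ N ∧ ∀ i ≤ γ.length, s (k + i) - z = (γ.take i).sum

section FollowsAt

variable {ok : ℤ × ℤ → ℤ × ℤ → Prop} {γ : List (ℤ × ℤ)}

theorem followsAt_of_word {x : ℕ → ℤ × ℤ} {N : ℕ} {a : ℤ × ℤ} {W₁ W₂ : List (ℤ × ℤ)}
    (hx : (List.range N).map x = W₁ ++ (γ ++ W₂)) (hok : OkWord ok a (W₁ ++ (γ ++ W₂)))
    (ha : a + W₁.sum = 0) : FollowsAt ok γ (path x) N (-a) := by
  have hlen : N = W₁.length + (γ.length + W₂.length) := by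
    simpa using congrArg List.length hx
  refine ⟨fun i hi => ?_, W₁.length, by omega, fun i hi => ?_⟩
  · rw [path_eq_take_sum x hi.le, path_eq_take_sum x (Nat.succ_le_of_lt hi), hx, sub_neg_eq_add,
      sub_neg_eq_add, add_comm, add_comm _ a]
    exact hok.ok_take (by simp; omega)
  · rw [path_eq_take_sum x (show W₁.length + i ≤ N by omega), hx, sub_neg_eq_add,
      List.take_length_add_append, List.sum_append, add_right_comm, add_comm _ a, ha, zero_add,
      List.take_append_of_le_length hi]

/-- The walk of `k` steps that ends at `b`, reversed from a word `u` that starts at `b` and avoids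
`B`, is at `b ∈ B` for the first time at time `k`. -/
theorem first_hit_of_word {B : Finset (ℤ × ℤ)} {k N : ℕ} {b : ℤ × ℤ} {x : ℕ → ℤ × ℤ}
    {u W : List (ℤ × ℤ)} (hu : u ∈ avoidWords B k b)
    (hx : (List.range N).map x = revWord u ++ W) :
    path x k - b = -(b + u.sum) ∧ ∀ i < k, path x i - (path x k - b) ∉ B := by
  have hlen := length_of_mem_avoidWords hu
  have hN : N = k + W.length := by
    simpa [revWord_length, hlen] using congrArg List.length hx
  have hk : path x k - b = -(b + u.sum) := by
    rw [path_eq_take_sum x (show k ≤ N by omega), hx,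
      List.take_append_of_le_length (by rw [revWord_length, hlen]),
      List.take_of_length_le (by rw [revWord_length, hlen]), revWord_sum]
    abel
  refine ⟨hk, fun i hi => ?_⟩
  rw [hk, path_eq_take_sum x (show i ≤ N by omega), hx,
    List.take_append_of_le_length (by rw [revWord_length, hlen]; omega), sub_neg_eq_add, add_comm,
    add_assoc, revWord_take_sum]
  exact take_sum_notMem_of_mem_avoidWords hu (by omega) (by omega)

/-- If a closed word from `b` to itself contains the word `γ` started from the origin, then for
each `k` the walk can follow it in the time interval `[k, k + ℓ]` and avoid `B` before and
after. Since `k` is then the first hitting time of the translate of `B`, distinct `k` lead to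
distinct translates. -/
theorem le_lintegral_followsAt (hsymm : ∀ a b, ok a b → ok b a) {B : Finset (ℤ × ℤ)}
    (hB : ∀ a, ∀ e ∈ unitSteps, a + e ∉ B → ok a (a + e)) {b : ℤ × ℤ} (hb : b ∈ B)
    {c c' : List (ℤ × ℤ)} (hsteps : ∀ e ∈ c ++ (γ ++ c'), e ∈ unitSteps)
    (hok : OkWord ok b (c ++ (γ ++ c'))) (hc : b + c.sum = 0) (hsum : (c ++ (γ ++ c')).sum = 0)
    {Ω : Type*} [MeasurableSpace Ω] {P : Measure Ω} {X : ℕ → Ω → ℤ × ℤ}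
    (hX : IsSRWIncrements P X) {N : ℕ} (hN : (c ++ (γ ++ c')).length ≤ N) :
    ENNReal.ofReal ((N - (c ++ (γ ++ c')).length : ℕ) *
        ((1 / 4) ^ (c ++ (γ ++ c')).length * avoidProb B N b ^ 2)) ≤
      ∫⁻ ω, ({z | FollowsAt ok γ (path fun j => X j ω) N z}.encard : ℝ≥0∞) ∂P := by
  classical
  set mid := c ++ (γ ++ c') with hmid
  set l := mid.length with hl
  let A : ℕ → Finset (List (ℤ × ℤ)) := fun k =>
    (avoidWords B k b ×ˢ avoidWords B (N - l - k) b).image fun p => revWord p.1 ++ (mid ++ p.2)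
  have hAmem : ∀ k W, W ∈ A k ↔ ∃ u ∈ avoidWords B k b, ∃ v ∈ avoidWords B (N - l - k) b,
      revWord u ++ (mid ++ v) = W := by
    intro k W
    simp only [A, Finset.mem_image, Finset.mem_product, Prod.exists]
    constructor
    · rintro ⟨u, v, ⟨hu, hv⟩, rfl⟩; exact ⟨u, hu, v, hv, rfl⟩
    · rintro ⟨u, hu, v, hv, rfl⟩; exact ⟨u, v, ⟨hu, hv⟩, rfl⟩
  have hAlen : ∀ k ≤ N - l, ∀ W ∈ A k, W.length = N := by
    intro k hk W hW
    obtain ⟨u, hu, v, hv, rfl⟩ := (hAmem k W).1 hW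
    rw [List.length_append, List.length_append, revWord_length, length_of_mem_avoidWords hu,
      length_of_mem_avoidWords hv, ← hl]
    omega
  have hAsteps : ∀ k, ∀ W ∈ A k, ∀ e ∈ W, e ∈ unitSteps := by
    intro k W hW e he
    obtain ⟨u, hu, v, hv, rfl⟩ := (hAmem k W).1 hW
    simp only [List.mem_append (t := mid ++ v), List.mem_append (s := mid)] at he
    rcases he with he | he | he
    exacts [mem_unitSteps_of_mem_revWord (mem_unitSteps_of_mem_avoidWords hu) e he,
      hsteps e he, mem_unitSteps_of_mem_avoidWords hv e he]
  have hAcard : ∀ k ≤ N - l, ((A k).card : ℝ) =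
      4 ^ (N - l) * (avoidProb B k b * avoidProb B (N - l - k) b) := by
    intro k hk
    rw [Finset.card_image_of_injOn, Finset.card_product, Nat.cast_mul, card_avoidWords,
      card_avoidWords]
    · rw [show (4 : ℝ) ^ (N - l) = 4 ^ k * 4 ^ (N - l - k) by
        rw [← pow_add, Nat.add_sub_cancel' hk]]
      ring
    · rintro ⟨u, v⟩ huv ⟨u', v'⟩ huv' h
      simp only [Finset.coe_product, Set.mem_prod, Finset.mem_coe] at huv huv'
      obtain ⟨h1, h2⟩ := List.append_inj h (by
        rw [revWord_length, revWord_length, length_of_mem_avoidWords huv.1,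
          length_of_mem_avoidWords huv'.1])
      exact Prod.ext (revWord_injective h1) (List.append_cancel_left h2)
  let E : ℕ → Set Ω := fun k => {ω | (List.range N).map (fun j => X j ω) ∈ A k}
  have hE : ∀ k ≤ N - l, MeasurableSet (E k) := fun k hk =>
    measurableSet_map_range_mem hX (hAlen k hk)
  have hPE : ∀ k ≤ N - l, ENNReal.ofReal ((1 / 4) ^ l * avoidProb B N b ^ 2) ≤ P (E k) := by
    intro k hk
    have hP : P (E k) = (A k).card * (1 / 4) ^ N :=
      measure_map_range_mem hX (hAlen k hk) (hAsteps k)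
    rw [hP, show ((A k).card : ℝ≥0∞) * (1 / 4) ^ N = ENNReal.ofReal ((A k).card * (1 / 4) ^ N) by
      rw [ENNReal.ofReal_mul (by positivity), ENNReal.ofReal_natCast,
        ENNReal.ofReal_pow (by norm_num), ENNReal.ofReal_div_of_pos (by norm_num)]
      norm_num]
    refine ENNReal.ofReal_le_ofReal ?_
    have h4 : (4 : ℝ) ^ (N - l) * (1 / 4) ^ N = (1 / 4) ^ l := by
      nth_rw 2 [← Nat.sub_add_cancel hN]
      rw [pow_add, ← mul_assoc, ← mul_pow]
      norm_num
    rw [hAcard k hk, mul_right_comm, h4, sq]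
    refine mul_le_mul_of_nonneg_left ?_ (by positivity)
    exact mul_le_mul (avoidProb_antitone B b (show k ≤ N by omega))
      (avoidProb_antitone B b (show N - l - k ≤ N by omega)) (avoidProb_nonneg _ _ _)
      (avoidProb_nonneg _ _ _)
  have hmem : ∀ k ≤ N - l, ∀ ω ∈ E k, FollowsAt ok γ (path fun j => X j ω) N
      (path (fun j => X j ω) k - b) ∧
      ∀ i < k, path (fun j => X j ω) i - (path (fun j => X j ω) k - b) ∉ B := by
    intro k hk ω hω
    obtain ⟨u, hu, v, hv, hW⟩ := (hAmem k _).1 hω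
    obtain ⟨h1, h2⟩ := first_hit_of_word hu hW.symm
    refine ⟨?_, h2⟩
    rw [h1]
    have hW' : revWord u ++ (mid ++ v) = (revWord u ++ c) ++ (γ ++ (c' ++ v)) := by
      simp [hmid, List.append_assoc]
    refine followsAt_of_word (hW.symm.trans hW') ?_ ?_
    · rw [← hW', okWord_append, okWord_append, revWord_sum, add_neg_cancel_right, hsum, add_zero]
      exact ⟨okWord_revWord hsymm (okWord_of_mem_avoidWords hB hu), hok,
        okWord_of_mem_avoidWords hB hv⟩
    · rw [List.sum_append, revWord_sum, ← add_assoc, add_neg_cancel_right, hc]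
  have hle : ∀ ω, ∑ k ∈ Finset.range (N - l), (E k).indicator (fun _ => (1 : ℝ≥0∞)) ω ≤
      ({z | FollowsAt ok γ (path fun j => X j ω) N z}.encard : ℝ≥0∞) := by
    intro ω
    set s := path fun j => X j ω with hs
    have h1 : ∑ k ∈ Finset.range (N - l), (E k).indicator (fun _ => (1 : ℝ≥0∞)) ω =
        (((Finset.range (N - l)).filter fun k => ω ∈ E k).card : ℝ≥0∞) := by
      simp only [Set.indicator_apply]
      exact (Finset.natCast_card_filter _ _).symm
    rw [h1, ← ENat.toENNReal_coe, ENat.toENNReal_le, ← Set.encard_coe_eq_coe_finsetCard]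
    have hlt : ∀ k ∈ Finset.range (N - l), k ≤ N - l := fun k hk => (Finset.mem_range.1 hk).le
    refine Set.encard_le_encard_of_injOn (f := fun k => s k - b) ?_ ?_
    · intro k hk
      rw [Finset.mem_coe, Finset.mem_filter] at hk
      exact (hmem k (hlt k hk.1) ω hk.2).1
    · have key : ∀ k k', ω ∈ E k' → k' ≤ N - l → k < k' → s k - b ≠ s k' - b := by
        intro k k' hk' hle hkk' heq
        refine (hmem k' hle ω hk').2 k hkk' ?_
        rw [← hs, ← heq, sub_sub_cancel]
        exact hb
      intro k hk k' hk' heq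
      rw [Finset.mem_coe, Finset.mem_filter] at hk hk'
      rcases lt_trichotomy k k' with h | h | h
      · exact absurd heq (key k k' hk'.2 (hlt _ hk'.1) h)
      · exact h
      · exact absurd heq.symm (key k' k hk.2 (hlt _ hk.1) h)
  calc ENNReal.ofReal ((N - l : ℕ) * ((1 / 4) ^ l * avoidProb B N b ^ 2))
      = ∑ k ∈ Finset.range (N - l), ENNReal.ofReal ((1 / 4) ^ l * avoidProb B N b ^ 2) := by
        rw [Finset.sum_const, Finset.card_range, nsmul_eq_mul, ENNReal.ofReal_mul (by positivity),
          ENNReal.ofReal_natCast]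
    _ ≤ ∑ k ∈ Finset.range (N - l), P (E k) :=
        Finset.sum_le_sum fun k hk => hPE k (Finset.mem_range.1 hk).le
    _ = ∫⁻ ω, ∑ k ∈ Finset.range (N - l), (E k).indicator (fun _ => (1 : ℝ≥0∞)) ω ∂P := by
        rw [lintegral_finsetSum' _ fun k hk => (measurable_const.indicator
          (hE k (Finset.mem_range.1 hk).le)).aemeasurable]
        refine Finset.sum_congr rfl fun k hk => ?_
        rw [lintegral_indicator (hE k (Finset.mem_range.1 hk).le)]
        simp
    _ ≤ _ := lintegral_mono hle

/-- The word `(e, -e, e, -e, …)` of `2 j` steps. -/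
def padWord (e : ℤ × ℤ) : ℕ → List (ℤ × ℤ)
  | 0 => []
  | j + 1 => e :: -e :: padWord e j

theorem padWord_sum (e : ℤ × ℤ) (j : ℕ) : (padWord e j).sum = 0 := by
  induction j with
  | zero => rfl
  | succ j ih => simp [padWord, ih]

theorem padWord_length (e : ℤ × ℤ) (j : ℕ) : (padWord e j).length = 2 * j := by
  induction j with
  | zero => rfl
  | succ j ih => simp [padWord, ih]; ring

theorem okWord_padWord (hsymm : ∀ a b, ok a b → ok b a) {e : ℤ × ℤ} (h : ok 0 (0 + e)) (j : ℕ) :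
    OkWord ok 0 (padWord e j) := by
  induction j with
  | zero => trivial
  | succ j ih =>
    refine ⟨h, ?_, ?_⟩
    · rw [add_neg_cancel_right]; exact hsymm _ _ h
    · rw [add_neg_cancel_right]; exact ih

theorem mem_unitSteps_of_mem_padWord {e : ℤ × ℤ} (he : e ∈ unitSteps) (j : ℕ) :
    ∀ f ∈ padWord e j, f ∈ unitSteps := by
  induction j with
  | zero => simp [padWord]
  | succ j ih => simpa [padWord, he, neg_mem_unitSteps he] using ih

theorem pow_le_lintegral_followsAt (hsymm : ∀ a b, ok a b → ok b a)
    (hγ : ∀ e ∈ γ, e ∈ unitSteps) (hγok : OkWord ok 0 γ) {m : ℕ} (hm : γ.length = 2 * m)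
    {e : ℤ × ℤ} (he : e ∈ unitSteps) (heok : ok 0 (0 + e))
    {Ω : Type*} [MeasurableSpace Ω] {P : Measure Ω} {X : ℕ → Ω → ℤ × ℤ}
    (hX : IsSRWIncrements P X) {n : ℕ} (hn : m ≤ n) :
    (1 / 4) ^ (2 * n) ≤
      ∫⁻ ω, ({z | FollowsAt ok γ (path fun j => X j ω) (2 * n) z}.encard : ℝ≥0∞) ∂P := by
  set W := padWord e (n - m) ++ (γ ++ []) with hW
  have hlen : W.length = 2 * n := by simp [hW, padWord_length, hm]; omega
  have hsteps : ∀ f ∈ W, f ∈ unitSteps := by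
    intro f hf
    simp only [hW, List.append_nil, List.mem_append] at hf
    exact hf.elim (mem_unitSteps_of_mem_padWord he _ f) (hγ f)
  rw [← measure_map_range_eq hX hlen hsteps, ← lintegral_indicator_one
    (measurableSet_map_range_eq hX hlen)]
  refine lintegral_mono fun ω => ?_
  refine Set.indicator_apply_le' (fun hω => ?_) fun _ => zero_le
  have h0 : FollowsAt ok γ (path fun j => X j ω) (2 * n) (-0) := by
    refine followsAt_of_word hω ?_ (by rw [padWord_sum, add_zero])
    rw [List.append_nil, okWord_append, padWord_sum, add_zero]
    exact ⟨okWord_padWord hsymm heok _, hγok⟩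
  rw [Pi.one_apply, ← ENat.toENNReal_one, ENat.toENNReal_le, Set.one_le_encard_iff_nonempty]
  exact ⟨_, h0⟩

theorem exists_log_bound {s : ℕ} (hs : 1 ≤ s) : ∃ C : ℝ, 0 < C ∧ ∀ n : ℕ, 2 ≤ n →
    2 * s * (1 + Real.log (2 * s * (2 * n : ℕ) + 1)) ≤ C * Real.log n := by
  have h2 : 0 < Real.log 2 := Real.log_pos one_lt_two
  have hs' : (1 : ℝ) ≤ s := by exact_mod_cast hs
  have h5 : 0 ≤ Real.log (5 * s) := Real.log_nonneg (by linarith)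
  refine ⟨2 * s * (1 / Real.log 2 + (Real.log (5 * s) / Real.log 2 + 1)), by
    have : (0 : ℝ) < s := by linarith
    positivity,
    fun n hn => ?_⟩
  have hn' : (2 : ℝ) ≤ n := by exact_mod_cast hn
  have hln : Real.log 2 ≤ Real.log n := Real.log_le_log zero_lt_two hn'
  rw [mul_assoc (2 * (s : ℝ)) _ (Real.log n)]
  refine mul_le_mul_of_nonneg_left ?_ (by positivity)
  have h1 : 1 ≤ Real.log n / Real.log 2 := (one_le_div h2).2 hln
  have h3 : Real.log (2 * s * (2 * n : ℕ) + 1) ≤ Real.log (5 * s) + Real.log n := by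
    rw [← Real.log_mul (by positivity) (by positivity)]
    refine Real.log_le_log (by positivity) ?_
    push_cast
    nlinarith
  have h4 := mul_le_mul_of_nonneg_left h1 h5
  calc _ ≤ Real.log n / Real.log 2 + (Real.log (5 * s) * (Real.log n / Real.log 2) + Real.log n) :=
        by linarith
    _ = _ := by ring

/-- If from every point of a finite set `B` at which the walk can leave `B` there is an admissible
path to the origin, then the expected number of points at which the walk of `2 n` steps follows
`γ` and which see only admissible edges is of order at least `n / log² n`. -/
theorem exists_le_lintegral_followsAt (hsymm : ∀ a b, ok a b → ok b a) {B : Finset (ℤ × ℤ)}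
    (h0 : (0 : ℤ × ℤ) ∈ B) (hB : ∀ a, ∀ e ∈ unitSteps, a + e ∉ B → ok a (a + e))
    (hconn : ∀ b ∈ B, (∃ e ∈ unitSteps, b + e ∉ B) →
      ∃ c : List (ℤ × ℤ), (∀ e ∈ c, e ∈ unitSteps) ∧ OkWord ok b c ∧ b + c.sum = 0)
    (hγ : ∀ e ∈ γ, e ∈ unitSteps) (hγok : OkWord ok 0 γ) {m : ℕ} (hm : γ.length = 2 * m) :
    ∃ K : ℝ, 0 < K ∧ ∀ (Ω : Type*) [MeasurableSpace Ω] (P : Measure Ω) (X : ℕ → Ω → ℤ × ℤ),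
      IsSRWIncrements P X → ∀ n : ℕ, m ≤ n →
        ENNReal.ofReal (K * (n / Real.log n ^ 2)) ≤
          ∫⁻ ω, ({z | FollowsAt ok γ (path fun j => X j ω) (2 * n) z}.encard : ℝ≥0∞) ∂P := by
  have hs : 1 ≤ B.card := Finset.card_pos.2 ⟨0, h0⟩
  have hlog0 (M : ℕ) : 0 ≤ Real.log (2 * B.card * M + 1) := Real.log_nonneg (by
    have : (0 : ℝ) ≤ 2 * B.card * M := by positivity
    linarith)
  have hexit (M : ℕ) (hM : 1 ≤ M) : ∃ b ∈ B, (∃ e ∈ unitSteps, b + e ∉ B) ∧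
      1 / (2 * B.card * (1 + Real.log (2 * B.card * M + 1))) ≤ avoidProb B M b := by
    obtain ⟨b, hb, hle⟩ := exists_le_avoidProb ⟨0, h0⟩ hM
    refine ⟨b, hb, exists_notMem_of_avoidProb_pos hM (lt_of_lt_of_le ?_ hle), hle⟩
    have := hlog0 M
    positivity
  obtain ⟨e₀, he₀, he₀ok⟩ : ∃ e ∈ unitSteps, ok 0 (0 + e) := by
    obtain ⟨b, hb, hex, -⟩ := hexit 1 le_rfl
    obtain ⟨c, hc, hcok, hcsum⟩ := hconn b hb hex
    have hr := okWord_revWord hsymm hcok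
    have hr' := mem_unitSteps_of_mem_revWord hc
    rw [hcsum] at hr
    cases hrev : revWord c with
    | nil =>
      obtain ⟨e, he, heB⟩ := hex
      have : c = [] := revWord_injective hrev
      rw [this, List.sum_nil, add_zero] at hcsum
      rw [hcsum] at heB
      exact ⟨e, he, hB 0 e he heB⟩
    | cons e w =>
      rw [hrev] at hr hr'
      exact ⟨e, hr' e (by simp), hr.1⟩
  choose! c hc hcok hcsum using hconn
  set L := 2 * (B.sup fun b => (c b).length) + 4 * m with hL
  obtain ⟨C, hC, hClog⟩ := exists_log_bound hs
  set n₀ := L + 2 with hn₀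
  have h2 : 0 < Real.log 2 := Real.log_pos one_lt_two
  set K₁ := (1 / 4 : ℝ) ^ L / C ^ 2 with hK₁
  set K₂ := (1 / 4 : ℝ) ^ (2 * n₀) * Real.log 2 ^ 2 / n₀ with hK₂
  have hn₀pos : (0 : ℝ) < n₀ := by positivity
  refine ⟨min K₁ K₂, lt_min (by positivity) (by positivity), fun Ω _ P X hX n hmn => ?_⟩
  rcases lt_or_ge n 2 with hn2 | hn2
  · -- for `n = 0` and `n = 1` the left side is zero
    have : (n : ℝ) / Real.log n ^ 2 = 0 := by interval_cases n <;> simp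
    rw [this, mul_zero, ENNReal.ofReal_zero]
    exact zero_le
  have hln : Real.log 2 ≤ Real.log n := Real.log_le_log zero_lt_two (by exact_mod_cast hn2)
  have hln0 : 0 < Real.log n := h2.trans_le hln
  have hfrac : 0 ≤ (n : ℝ) / Real.log n ^ 2 := by positivity
  rcases lt_or_ge n n₀ with hlt | hge
  · -- few steps: one word suffices
    refine le_trans ?_ (pow_le_lintegral_followsAt hsymm hγ hγok hm he₀ he₀ok hX hmn)
    rw [show ((1 / 4 : ℝ≥0∞) ^ (2 * n)) = ENNReal.ofReal ((1 / 4) ^ (2 * n)) by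
      rw [ENNReal.ofReal_pow (by norm_num), ENNReal.ofReal_div_of_pos (by norm_num)]; norm_num]
    refine ENNReal.ofReal_le_ofReal ?_
    have hfr : (n : ℝ) / Real.log n ^ 2 ≤ n₀ / Real.log 2 ^ 2 := by
      gcongr
    calc min K₁ K₂ * (n / Real.log n ^ 2) ≤ K₂ * (n₀ / Real.log 2 ^ 2) :=
          mul_le_mul (min_le_right _ _) hfr hfrac (by positivity)
      _ = (1 / 4) ^ (2 * n₀) := by rw [hK₂]; field_simp
      _ ≤ (1 / 4) ^ (2 * n) :=
          pow_le_pow_of_le_one (by norm_num) (by norm_num) (by omega)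
  · obtain ⟨b, hb, hex, hle⟩ := hexit (2 * n) (by omega)
    -- the loop from `b` along `γ` and back
    set c' := revWord γ ++ revWord (c b) with hc'
    have hmidsum : (c b ++ (γ ++ c')).sum = 0 := by
      simp only [hc', List.sum_append, revWord_sum]; abel
    have hmidlen : (c b ++ (γ ++ c')).length ≤ L := by
      have : (c b).length ≤ B.sup fun b => (c b).length :=
        Finset.le_sup (f := fun b => (c b).length) hb
      simp only [hc', List.length_append, revWord_length, hm, hL]
      omega
    have hsteps : ∀ e ∈ c b ++ (γ ++ c'), e ∈ unitSteps := by
      intro e he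
      simp only [hc', List.mem_append] at he
      rcases he with h | h | h | h
      exacts [hc b hb hex e h, hγ e h, mem_unitSteps_of_mem_revWord hγ e h,
        mem_unitSteps_of_mem_revWord (hc b hb hex) e h]
    have hmidok : OkWord ok b (c b ++ (γ ++ c')) := by
      have hr := okWord_revWord hsymm (hcok b hb hex)
      have hr' := okWord_revWord hsymm hγok
      rw [hcsum b hb hex] at hr
      rw [hc', okWord_append, okWord_append, okWord_append, hcsum b hb hex, revWord_sum,
        add_neg_cancel_right]
      exact ⟨hcok b hb hex, hγok, hr', hr⟩
    refine le_trans (ENNReal.ofReal_le_ofReal ?_) (le_lintegral_followsAt hsymm hB hb hsteps hmidok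
      (hcsum b hb hex) hmidsum hX (N := 2 * n) (by omega))
    have hq : 1 / (C * Real.log n) ≤ avoidProb B (2 * n) b := by
      refine (one_div_le_one_div_of_le ?_ (hClog n hn2)).trans hle
      have := hlog0 (2 * n)
      positivity
    have hnum : (n : ℝ) ≤ (2 * n - (c b ++ (γ ++ c')).length : ℕ) := by
      exact_mod_cast (show n ≤ 2 * n - (c b ++ (γ ++ c')).length by omega)
    calc min K₁ K₂ * (n / Real.log n ^ 2) ≤ K₁ * (n / Real.log n ^ 2) :=
          mul_le_mul_of_nonneg_right (min_le_left _ _) hfrac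
      _ = n * ((1 / 4) ^ L * (1 / (C * Real.log n)) ^ 2) := by rw [hK₁]; field_simp
      _ ≤ _ := by
        refine mul_le_mul hnum (mul_le_mul ?_ ?_ (by positivity) (by positivity)) (by positivity)
          (by positivity)
        · exact pow_le_pow_of_le_one (by norm_num) (by norm_num) hmidlen
        · exact pow_le_pow_left₀ (by positivity) hq 2

end FollowsAt

/-! ### Lattice paths outside a hole -/

theorem exists_word_to_zero (v : ℤ × ℤ) :
    ∃ w : List (ℤ × ℤ), (∀ e ∈ w, e ∈ unitSteps) ∧ v + w.sum = 0 := by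
  obtain ⟨a, b⟩ := v
  refine ⟨List.replicate a.natAbs (-a.sign, 0) ++ List.replicate b.natAbs (0, -b.sign),
    fun e he => ?_, ?_⟩
  · rw [List.mem_append, List.mem_replicate, List.mem_replicate] at he
    rcases he with ⟨h, rfl⟩ | ⟨h, rfl⟩
    · rcases lt_trichotomy a 0 with h' | h' | h'
      · rw [Int.sign_eq_neg_one_of_neg h']; decide
      · simp [h'] at h
      · rw [Int.sign_eq_one_of_pos h']; decide
    · rcases lt_trichotomy b 0 with h' | h' | h'
      · rw [Int.sign_eq_neg_one_of_neg h']; decide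
      · simp [h'] at h
      · rw [Int.sign_eq_one_of_pos h']; decide
  · have ha := Int.sign_mul_abs a
    have hb := Int.sign_mul_abs b
    rw [mul_comm] at ha hb
    rw [List.sum_append, List.sum_replicate, List.sum_replicate]
    ext
    · simpa using by linarith
    · simpa using by linarith

theorem sum_map_range (x : ℕ → ℤ × ℤ) (N : ℕ) : ((List.range N).map x).sum = path x N := by
  rw [path_eq_take_sum x le_rfl, List.take_of_length_le (by simp)]

theorem okWord_map_range {ok : ℤ × ℤ → ℤ × ℤ → Prop} {x : ℕ → ℤ × ℤ} {N : ℕ}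
    (h : ∀ i < N, ok (path x i) (path x (i + 1))) : OkWord ok 0 ((List.range N).map x) := by
  induction N with
  | zero => trivial
  | succ N ih =>
    rw [List.range_succ, List.map_append, okWord_append, sum_map_range, zero_add]
    refine ⟨ih fun i hi => h i (by omega), ?_, trivial⟩
    have := h N (by omega)
    rwa [show path x (N + 1) = path x N + x N from Finset.sum_range_succ _ _] at this

/-- Every point outside the hole can be joined to the origin by admissible edges: go towards the
origin until the path that makes the hole is met, then go back along this path. -/
theorem exists_okWord_to_zero {ok : ℤ × ℤ → ℤ × ℤ → Prop} (hsymm : ∀ a b, ok a b → ok b a)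
    {x : ℕ → ℤ × ℤ} (hx : ∀ j, x j ∈ unitSteps) {N : ℕ}
    (hok : OkWord ok 0 ((List.range N).map x)) {G : Set (ℤ × ℤ)}
    (hstep : ∀ v ∉ latticeTrace (path x) N, v ∉ G → ∀ e ∈ unitSteps, ok v (v + e) ∧ v + e ∉ G)
    {v : ℤ × ℤ} (hv : v ∉ G) :
    ∃ c : List (ℤ × ℤ), (∀ e ∈ c, e ∈ unitSteps) ∧ OkWord ok v c ∧ v + c.sum = 0 := by
  have htrace (v : ℤ × ℤ) (hv : v ∈ latticeTrace (path x) N) :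
      ∃ c : List (ℤ × ℤ), (∀ e ∈ c, e ∈ unitSteps) ∧ OkWord ok v c ∧ v + c.sum = 0 := by
    obtain ⟨k, hk, rfl⟩ := hv
    have h := okWord_revWord hsymm (hok.take k)
    rw [zero_add, ← path_eq_take_sum x hk] at h
    refine ⟨_, mem_unitSteps_of_mem_revWord fun e he => ?_, h, ?_⟩
    · obtain ⟨j, _, rfl⟩ := List.mem_map.1 (List.mem_of_mem_take he)
      exact hx j
    · rw [revWord_sum, ← path_eq_take_sum x hk, add_neg_cancel]
  obtain ⟨w, hw, hsum⟩ := exists_word_to_zero v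
  induction w generalizing v with
  | nil =>
    refine htrace v ⟨0, Nat.zero_le _, ?_⟩
    rw [List.sum_nil, add_zero] at hsum
    rw [hsum, path, Finset.sum_range_zero]
  | cons e w ih =>
    by_cases hvT : v ∈ latticeTrace (path x) N
    · exact htrace v hvT
    · have he : e ∈ unitSteps := hw e (by simp)
      obtain ⟨h1, h2⟩ := hstep v hvT hv e he
      obtain ⟨c, hc, hcok, hcsum⟩ := ih h2 (fun f hf => hw f (by simp [hf]))
        (by rw [← hsum, List.sum_cons, add_assoc])
      exact ⟨e :: c, by simpa [he] using hc, ⟨h1, hcok⟩, by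
        rw [← hcsum, List.sum_cons, add_assoc]⟩

/-- The lower bound for the number of undisturbed copies of the path `x`, when `G` plays the role
of the set of lattice points of the hole and only finitely many edges are not admissible. -/
theorem exists_le_lintegral_of_finite {ok : ℤ × ℤ → ℤ × ℤ → Prop}
    (hsymm : ∀ a b, ok a b → ok b a) {G : Set (ℤ × ℤ)}
    (hG : ∀ a ∈ G, ∀ e ∈ unitSteps, ¬ ok a (a + e))
    (hfin : {a : ℤ × ℤ | ∃ e ∈ unitSteps, ¬ ok a (a + e)}.Finite)
    {x : ℕ → ℤ × ℤ} (hx : ∀ j, x j ∈ unitSteps) {m : ℕ}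
    (hok : ∀ i < 2 * m, ok (path x i) (path x (i + 1)))
    (hstep : ∀ v ∉ latticeTrace (path x) (2 * m), v ∉ G →
      ∀ e ∈ unitSteps, ok v (v + e) ∧ v + e ∉ G) :
    ∃ K : ℝ, 0 < K ∧ ∀ (Ω : Type*) [MeasurableSpace Ω] (P : Measure Ω) (X : ℕ → Ω → ℤ × ℤ),
      IsSRWIncrements P X → ∀ n : ℕ, m ≤ n →
        ENNReal.ofReal (K * (n / Real.log n ^ 2)) ≤
          ∫⁻ ω, ({z | FollowsAt ok ((List.range (2 * m)).map x)
            (path fun j => X j ω) (2 * n) z}.encard : ℝ≥0∞) ∂P := by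
  classical
  have hB : ∀ a, ∀ e ∈ unitSteps, a + e ∉ insert 0 hfin.toFinset → ok a (a + e) := by
    intro a e he ha
    by_contra hno
    refine ha (Finset.mem_insert_of_mem (hfin.mem_toFinset.2 ⟨-e, neg_mem_unitSteps he, ?_⟩))
    rw [add_neg_cancel_right]
    exact fun h => hno (hsymm _ _ h)
  refine exists_le_lintegral_followsAt hsymm (B := insert 0 hfin.toFinset)
    (Finset.mem_insert_self _ _) hB ?_ ?_ (okWord_map_range hok) (by simp)
  · rintro b - ⟨e, he, hbe⟩
    exact exists_okWord_to_zero hsymm hx (okWord_map_range hok) hstep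
      fun hbG => hG b hbG e he (hB b e he hbe)
  · intro e he
    obtain ⟨j, _, rfl⟩ := List.mem_map.1 he
    exact hx j

/-- A walk that follows `x` from `z` visits the translate of the lattice trace of `x`. -/
theorem FollowsAt.exists_path_eq {ok : ℤ × ℤ → ℤ × ℤ → Prop} {x s : ℕ → ℤ × ℤ} {N M : ℕ}
    {z : ℤ × ℤ} (h : FollowsAt ok ((List.range M).map x) s N z) :
    ∃ k, k + M ≤ N ∧ ∀ i ≤ M, s (k + i) = path x i + z := by
  obtain ⟨-, k, hk, hs⟩ := h
  rw [List.length_map, List.length_range] at hk hs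
  refine ⟨k, hk, fun i hi => ?_⟩
  rw [path_eq_take_sum x hi, ← hs i hi, sub_add_cancel]

/-! ### Lattice holes -/

theorem latticeGraph_adj_add {v e : ℤ × ℤ} (he : e ∈ unitSteps) : latticeGraph.Adj (v + e) v := by
  rw [latticeGraph, SimpleGraph.fromRel_adj]
  refine ⟨?_, Or.inr (by rwa [add_sub_cancel_left])⟩
  rw [Ne, add_eq_left]
  rintro rfl
  revert he
  decide

/-- Translation by a lattice point, as an endomorphism of the nearest-neighbour graph. -/
def latticeShift (z : ℤ × ℤ) : latticeGraph →g latticeGraph where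
  toFun v := v + z
  map_rel' {a b} h := by
    rw [latticeGraph, SimpleGraph.fromRel_adj] at h ⊢
    rwa [add_sub_add_right_eq_sub, add_sub_add_right_eq_sub, Ne, add_left_inj]

theorem exists_walk_translate {z a b a' b' : ℤ × ℤ} (p : latticeGraph.Walk a b)
    (ha : a + z = a') (hb : b + z = b') :
    ∃ q : latticeGraph.Walk a' b', ∀ u ∈ q.support, u + -z ∈ p.support := by
  subst ha hb
  refine ⟨p.map (latticeShift z), fun u hu => ?_⟩
  have hu' : u ∈ (p.map (latticeShift z)).support := hu
  rw [SimpleGraph.Walk.support_map, List.mem_map] at hu'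
  obtain ⟨v, hv, rfl⟩ := hu'
  rwa [show latticeShift z v = v + z from rfl, add_neg_cancel_right]

theorem isLatticeHole_translate {s t : ℕ → ℤ × ℤ} {N M : ℕ} {G : Set (ℤ × ℤ)} {z : ℤ × ℤ}
    (hG : IsLatticeHole t M G) (hsub : ∀ v ∈ latticeTrace t M, v + z ∈ latticeTrace s N)
    (hdisj : ∀ v ∈ G, v + z ∉ latticeTrace s N) : IsLatticeHole s N (latticeTranslate G z) := by
  obtain ⟨w, hw, rfl⟩ := hG
  refine ⟨w + z, hdisj w ⟨SimpleGraph.Walk.nil, by simpa using hw⟩, ?_⟩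
  ext v
  constructor
  · rintro ⟨v, ⟨p, hp⟩, rfl⟩
    obtain ⟨q, hq⟩ := exists_walk_translate p (z := z) rfl rfl
    refine ⟨q, fun u hu => ?_⟩
    have := hdisj (u + -z) ⟨p.takeUntil _ (hq u hu),
      fun u' hu' => hp u' (p.support_takeUntil_subset_support _ hu')⟩
    rwa [neg_add_cancel_right] at this
  · rintro ⟨q, hq⟩
    obtain ⟨p, hp⟩ := exists_walk_translate q (z := -z) (add_neg_cancel_right w z) rfl
    refine ⟨v + -z, ⟨p, fun u hu huT => ?_⟩, neg_add_cancel_right v z⟩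
    have := hp u hu
    rw [neg_neg] at this
    exact hq _ this (hsub u huT)

theorem exists_le_lintegral_latticeHoleCount {m : ℕ} {H : Set (ℤ × ℤ)}
    (hH : H ∈ latticeHoleShapes m) :
    ∃ K : ℝ, 0 < K ∧ ∀ (Ω : Type*) [MeasurableSpace Ω] (P : Measure Ω) (X : ℕ → Ω → ℤ × ℤ),
      IsSRWIncrements P X → ∀ n : ℕ, m ≤ n →
        ENNReal.ofReal (K * (n / Real.log n ^ 2)) ≤
          ∫⁻ ω, (latticeHoleCount (path fun j => X j ω) n H : ℝ≥0∞) ∂P := by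
  obtain ⟨hfin, x, hx, z₀, hhole⟩ := hH
  set G := latticeTranslate H z₀ with hGdef
  have hGfin : G.Finite := hfin.image _
  have hhole' := hhole
  obtain ⟨w, hw, hGw⟩ := hhole'
  have hGT : ∀ v ∈ G, v ∉ latticeTrace (path x) (2 * m) := by
    intro v hv
    rw [hGw] at hv
    obtain ⟨p, hp⟩ := hv
    exact hp v p.end_mem_support
  have hpath : ∀ i ≤ 2 * m, path x i ∉ G := fun i hi h => hGT _ h ⟨i, hi, rfl⟩
  obtain ⟨K, hK, hbound⟩ := exists_le_lintegral_of_finite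
    (ok := fun a b => a ∉ G ∧ b ∉ G) (fun a b h => ⟨h.2, h.1⟩) (G := G)
    (fun a ha e _ h => h.1 ha)
    (((hGfin.union (hGfin.image2 (· - ·) unitSteps.finite_toSet))).subset (by
      rintro a ⟨e, he, hno⟩
      by_cases ha : a ∈ G
      · exact Or.inl ha
      · refine Or.inr ⟨a + e, ?_, e, he, add_sub_cancel_right a e⟩
        by_contra h
        exact hno ⟨ha, h⟩))
    hx (m := m) (fun i hi => ⟨hpath i hi.le, hpath (i + 1) hi⟩) (by
      intro v hvT hvG e he
      have : v + e ∉ G := by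
        intro h
        rw [hGw] at h
        obtain ⟨p, hp⟩ := h
        refine hvG ?_
        rw [hGw]
        refine ⟨p.concat (latticeGraph_adj_add he), fun u hu => ?_⟩
        rw [SimpleGraph.Walk.support_concat, List.mem_append] at hu
        rcases hu with hu | hu
        · exact hp u hu
        · rw [List.mem_singleton] at hu
          rwa [hu]
      exact ⟨⟨hvG, this⟩, this⟩)
  refine ⟨K, hK, fun Ω _ P X hX n hn => (hbound Ω P X hX n hn).trans ?_⟩
  refine lintegral_mono fun ω => ENat.toENNReal_le.2 ?_
  refine Set.encard_le_encard_of_injOn (f := fun z => z₀ + z) ?_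
    (fun a _ b _ h => add_left_cancel h)
  intro z hz
  rw [Set.mem_ofPred_eq] at hz
  obtain ⟨k, hk, hs⟩ := hz.exists_path_eq
  set s := path fun j => X j ω
  rw [Set.mem_ofPred_eq, show latticeTranslate H (z₀ + z) = latticeTranslate G z by
    rw [hGdef, latticeTranslate, latticeTranslate, latticeTranslate, Set.image_image]
    simp only [add_assoc]]
  refine isLatticeHole_translate hhole ?_ ?_
  · rintro v ⟨i, hi, rfl⟩
    exact ⟨k + i, by omega, hs i hi⟩
  · rintro v hv ⟨j, hj, hjv⟩
    have hv' : v = s j - z := by rw [hjv, add_sub_cancel_right]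
    rcases hj.lt_or_eq with hj | rfl
    · exact (hz.1 j hj).1 (hv' ▸ hv)
    · rcases Nat.eq_zero_or_pos n with rfl | hn0
      · -- without any step, the walk is at the starting point of the translated path
        have h0 := hs 0 (Nat.zero_le _)
        rw [show k + 0 = 2 * 0 by omega] at h0
        refine hpath 0 (Nat.zero_le _) ?_
        rwa [hv', h0, add_sub_cancel_right] at hv
      · have := (hz.1 (2 * n - 1) (by omega)).2
        rw [Nat.sub_add_cancel (by omega)] at this
        exact this (hv' ▸ hv)

/-! ### Plane holes -/

theorem toComplex_add (a b : ℤ × ℤ) : toComplex (a + b) = toComplex a + toComplex b := by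
  apply Complex.ext <;> simp [toComplex]

theorem toComplex_sub (a b : ℤ × ℤ) : toComplex (a - b) = toComplex a - toComplex b := by
  apply Complex.ext <;> simp [toComplex]

theorem mem_trace_iff {s : ℕ → ℤ × ℤ} {N : ℕ} {y : ℂ} :
    y ∈ trace s N ↔ ∃ i ≤ N, ∃ θ : ℝ, 0 ≤ θ ∧ θ < 1 ∧ (i = N → θ = 0) ∧
      y = toComplex (s i) + (θ : ℂ) * (toComplex (s (i + 1)) - toComplex (s i)) := by
  constructor
  · rintro ⟨t, ⟨ht0, htN⟩, rfl⟩
    refine ⟨⌊t⌋₊, Nat.floor_le_of_le htN, t - ⌊t⌋₊, sub_nonneg.2 (Nat.floor_le ht0),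
      sub_lt_iff_lt_add'.2 (Nat.lt_floor_add_one t), fun h => ?_, rfl⟩
    have := Nat.floor_le ht0
    rw [h] at this ⊢
    linarith
  · rintro ⟨i, hi, θ, h0, h1, hN, rfl⟩
    have hfl : ⌊(i : ℝ) + θ⌋₊ = i :=
      (Nat.floor_eq_iff (by positivity)).2 ⟨by linarith, by linarith⟩
    refine ⟨i + θ, ⟨by positivity, ?_⟩, ?_⟩
    · rcases hi.lt_or_eq with hlt | rfl
      · have : (i : ℝ) + 1 ≤ N := by exact_mod_cast hlt
        linarith
      · rw [hN rfl, add_zero]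
    · rw [interp, hfl, add_sub_cancel_left]

theorem toComplex_mem_trace (s : ℕ → ℤ × ℤ) {i N : ℕ} (hi : i ≤ N) :
    toComplex (s i) ∈ trace s N :=
  mem_trace_iff.2 ⟨i, hi, 0, le_rfl, zero_lt_one, fun _ => rfl, by simp⟩

theorem segment_subset_trace (s : ℕ → ℤ × ℤ) {i N : ℕ} (hi : i < N) :
    segment ℝ (toComplex (s i)) (toComplex (s (i + 1))) ⊆ trace s N := by
  rw [segment_eq_image']
  rintro _ ⟨θ, ⟨h0, h1⟩, rfl⟩
  rcases h1.lt_or_eq with h1 | rfl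
  · exact mem_trace_iff.2 ⟨i, hi.le, θ, h0, h1, fun h => absurd h hi.ne, by simp⟩
  · simpa using toComplex_mem_trace s (Nat.succ_le_of_lt hi)

theorem mem_segment_or_of_mem_trace {s : ℕ → ℤ × ℤ} {N : ℕ} {y : ℂ} (hy : y ∈ trace s N) :
    (∃ i < N, y ∈ segment ℝ (toComplex (s i)) (toComplex (s (i + 1)))) ∨
      y = toComplex (s N) := by
  obtain ⟨i, hi, θ, h0, h1, hN, rfl⟩ := mem_trace_iff.1 hy
  rcases hi.lt_or_eq with hlt | rfl
  · refine Or.inl ⟨i, hlt, ?_⟩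
    rw [segment_eq_image']
    exact ⟨θ, ⟨h0, h1.le⟩, by simp⟩
  · exact Or.inr (by simp [hN rfl])

/-- Two lattice edges meet only at lattice points. -/
theorem eq_or_eq_add_of_edges_meet {v p e e' : ℤ × ℤ} (he : e ∈ unitSteps) (he' : e' ∈ unitSteps)
    {t t' : ℝ} (ht : 0 ≤ t) (ht1 : t < 1) (ht' : 0 ≤ t') (ht1' : t' < 1)
    (h : toComplex v + (t : ℂ) * toComplex e = toComplex p + (t' : ℂ) * toComplex e') :
    v = p ∨ (t' ≠ 0 ∧ v = p + e') := by
  obtain ⟨v₁, v₂⟩ := v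
  obtain ⟨p₁, p₂⟩ := p
  have h1 := congrArg Complex.re h
  have h2 := congrArg Complex.im h
  have int_eq (a b c : ℤ) (h1 : (a : ℝ) - b < c + 1) (h2 : (c : ℝ) - 1 < a - b) :
      a = b + c := by
    have h1' : a - b < c + 1 := by exact_mod_cast h1
    have h2' : c - 1 < a - b := by exact_mod_cast h2
    omega
  have eq_add (c₁ c₂ : ℤ) (h1 : (v₁ : ℝ) - p₁ < c₁ + 1) (h2 : (c₁ : ℝ) - 1 < v₁ - p₁)
      (h3 : (v₂ : ℝ) - p₂ < c₂ + 1) (h4 : (c₂ : ℝ) - 1 < v₂ - p₂) :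
      ((v₁, v₂) : ℤ × ℤ) = (p₁, p₂) + (c₁, c₂) := by
    rw [int_eq _ _ _ h1 h2, int_eq _ _ _ h3 h4, Prod.mk_add_mk]
  simp only [unitSteps, Finset.mem_insert, Finset.mem_singleton] at he he'
  by_cases h0 : t' = 0
  · left
    rw [← add_zero (p₁, p₂)]
    rcases he with rfl | rfl | rfl | rfl <;>
    · simp [toComplex, h0, -Int.cast_inj] at h1 h2
      exact eq_add 0 0 (by push_cast; linarith) (by push_cast; linarith) (by push_cast; linarith)
        (by push_cast; linarith)
  · have h0' : 0 < t' := lt_of_le_of_ne ht' (Ne.symm h0)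
    -- each coordinate of the integer point `v - p` is less than one away from that of `0`, or,
    -- if `e = -e'`, from that of `e'`
    rcases he with rfl | rfl | rfl | rfl <;> rcases he' with rfl | rfl | rfl | rfl <;>
    · simp [toComplex, -Int.cast_inj] at h1 h2
      first
        | exact Or.inl ((eq_add 0 0 (by push_cast; linarith) (by push_cast; linarith)
            (by push_cast; linarith) (by push_cast; linarith)).trans (add_zero _))
        | exact Or.inr ⟨h0, eq_add _ _ (by push_cast; linarith) (by push_cast; linarith)
            (by push_cast; linarith) (by push_cast; linarith)⟩

theorem eq_translate_translate (H : Set ℂ) (z₀ z : ℤ × ℤ) :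
    translate H (z₀ + z) = translate (translate H z₀) z := by
  rw [translate, translate, translate, Set.image_image]
  simp only [toComplex_add, add_assoc]

theorem isHole_translate {s t : ℕ → ℤ × ℤ} {N M : ℕ} {G : Set ℂ} {z : ℤ × ℤ}
    (hG : IsHole t M G) (hsub : ∀ y ∈ trace t M, y + toComplex z ∈ trace s N)
    (hdisj : ∀ y ∈ G, y + toComplex z ∉ trace s N) : IsHole s N (translate G z) := by
  obtain ⟨w, hw, rfl⟩ := hG
  have hw' : w ∈ connectedComponentIn (trace t M)ᶜ w := mem_connectedComponentIn hw
  have hwz : w + toComplex z ∈ (trace s N)ᶜ := hdisj w hw'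
  refine ⟨w + toComplex z, hwz, Set.Subset.antisymm ?_ ?_⟩
  · refine IsPreconnected.subset_connectedComponentIn
      (isPreconnected_connectedComponentIn.image _ (by fun_prop)) ⟨w, hw', rfl⟩ ?_
    rintro _ ⟨y, hy, rfl⟩
    exact hdisj y hy
  · intro y hy
    refine ⟨y - toComplex z, ?_, sub_add_cancel _ _⟩
    refine IsPreconnected.subset_connectedComponentIn
      (s := (fun u => u - toComplex z) '' connectedComponentIn (trace s N)ᶜ (w + toComplex z))
      (isPreconnected_connectedComponentIn.image _ (by fun_prop))
      ⟨_, mem_connectedComponentIn hwz, add_sub_cancel_right _ _⟩ ?_ ⟨y, hy, rfl⟩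
    rintro _ ⟨u, hu, rfl⟩ huT
    refine connectedComponentIn_subset _ _ hu ?_
    simpa using hsub _ huT

theorem finite_setOf_norm_toComplex_le (R : ℝ) : {a : ℤ × ℤ | ‖toComplex a‖ ≤ R}.Finite := by
  refine ((Set.finite_Icc (-⌈R⌉) ⌈R⌉).prod (Set.finite_Icc (-⌈R⌉) ⌈R⌉)).subset ?_
  rintro ⟨a, b⟩ h
  rw [Set.mem_ofPred_eq] at h
  have bound (c : ℤ) (hc : |(c : ℝ)| ≤ R) : c ∈ Set.Icc (-⌈R⌉) ⌈R⌉ := by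
    have : |c| ≤ ⌈R⌉ := by exact_mod_cast hc.trans (Int.le_ceil R)
    exact abs_le.1 this
  exact ⟨bound a ((Complex.abs_re_le_norm _).trans h), bound b ((Complex.abs_im_le_norm _).trans h)⟩

theorem norm_toComplex_of_mem_unitSteps {e : ℤ × ℤ} (he : e ∈ unitSteps) : ‖toComplex e‖ = 1 := by
  simp only [unitSteps, Finset.mem_insert, Finset.mem_singleton] at he
  rcases he with rfl | rfl | rfl | rfl <;> simp [toComplex, Complex.norm_def, Complex.normSq_apply]

/-- A lattice edge that starts outside the hole and off the path does not meet the hole, because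
it can enter the hole only through the path, which contains no point of the edge except possibly
the other endpoint. -/
theorem disjoint_segment_of_notMem {x : ℕ → ℤ × ℤ} (hx : ∀ j, x j ∈ unitSteps) {N : ℕ}
    {G : Set ℂ} (hG : IsHole (path x) N G) {v e : ℤ × ℤ} (he : e ∈ unitSteps)
    (hvT : v ∉ latticeTrace (path x) N) (hvG : toComplex v ∉ G) :
    Disjoint (segment ℝ (toComplex v) (toComplex (v + e))) G := by
  obtain ⟨w, hw, rfl⟩ := hG
  rw [Set.disjoint_left]
  intro y hy hyG
  have hyT := connectedComponentIn_subset _ _ hyG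
  rw [segment_eq_image'] at hy
  obtain ⟨τ, ⟨hτ0, hτ1⟩, rfl⟩ := hy
  rw [toComplex_add, add_sub_cancel_left] at hyG hyT
  set y := toComplex v + τ • toComplex e with hy
  have hseg : segment ℝ (toComplex v) y ⊆ (trace (path x) N)ᶜ := by
    rw [segment_eq_image', hy, add_sub_cancel_left]
    rintro _ ⟨r, ⟨hr0, hr1⟩, rfl⟩ hmem
    simp only [smul_smul] at hmem
    have hrτ : r * τ ≤ τ := mul_le_of_le_one_left hτ0 hr1
    rcases (hrτ.trans hτ1).lt_or_eq with hlt | heq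
    · obtain ⟨i, hi, θ, h0, h1, hN, heq⟩ := mem_trace_iff.1 hmem
      have hs : path x (i + 1) = path x i + x i := Finset.sum_range_succ _ _
      rw [hs, toComplex_add, add_sub_cancel_left, Complex.real_smul] at heq
      rcases eq_or_eq_add_of_edges_meet he (hx i) (by positivity) hlt h0 h1 heq with h | ⟨hθ, h⟩
      · exact hvT ⟨i, hi, h.symm⟩
      · refine hvT ⟨i + 1, ?_, hs.trans h.symm⟩
        exact Nat.succ_le_of_lt (lt_of_le_of_ne hi fun h => hθ (hN h))
    · have : r * τ = τ := le_antisymm hrτ (by rw [heq]; exact hτ1)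
      rw [this] at hmem
      exact hyT hmem
  refine hvG ?_
  rw [connectedComponentIn_eq hyG]
  exact (convex_segment _ _).isPreconnected.subset_connectedComponentIn
    (right_mem_segment ℝ _ _) hseg (left_mem_segment ℝ _ _)

theorem exists_le_lintegral_holeCount {m : ℕ} {H : Set ℂ} (hH : H ∈ holeShapes m) :
    ∃ K : ℝ, 0 < K ∧ ∀ (Ω : Type*) [MeasurableSpace Ω] (P : Measure Ω) (X : ℕ → Ω → ℤ × ℤ),
      IsSRWIncrements P X → ∀ n : ℕ, m ≤ n →
        ENNReal.ofReal (K * (n / Real.log n ^ 2)) ≤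
          ∫⁻ ω, (holeCount (path fun j => X j ω) n H : ℝ≥0∞) ∂P := by
  obtain ⟨hbdd, x, hx, z₀, hhole⟩ := hH
  set G := translate H z₀ with hGdef
  obtain ⟨R, hR⟩ := hbdd.exists_norm_le
  have hGR : ∀ y ∈ G, ‖y‖ ≤ R + ‖toComplex z₀‖ := by
    rintro _ ⟨y, hy, rfl⟩
    exact (norm_add_le _ _).trans (add_le_add_left (hR y hy) _)
  have hGT : ∀ y ∈ G, y ∉ trace (path x) (2 * m) := by
    obtain ⟨w, hw, hGw⟩ := hhole
    rw [hGw]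
    exact fun y hy => connectedComponentIn_subset _ _ hy
  obtain ⟨K, hK, hbound⟩ := exists_le_lintegral_of_finite
    (ok := fun a b => Disjoint (segment ℝ (toComplex a) (toComplex b)) G)
    (fun a b h => by rwa [segment_symm]) (G := {a | toComplex a ∈ G})
    (fun a ha e _ h => Set.disjoint_left.1 h (left_mem_segment ℝ _ _) ha)
    ((finite_setOf_norm_toComplex_le (R + ‖toComplex z₀‖ + 1)).subset (by
      rintro a ⟨e, he, hno⟩
      rw [Set.not_disjoint_iff] at hno
      obtain ⟨y, hy, hyG⟩ := hno
      rw [segment_eq_image'] at hy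
      obtain ⟨θ, ⟨h0, h1⟩, rfl⟩ := hy
      rw [toComplex_add, add_sub_cancel_left] at hyG
      have h2 : ‖θ • toComplex e‖ ≤ 1 := by
        rw [norm_smul, norm_toComplex_of_mem_unitSteps he, mul_one, Real.norm_of_nonneg h0]
        exact h1
      have h3 := norm_sub_le (toComplex a + θ • toComplex e) (θ • toComplex e)
      rw [add_sub_cancel_right] at h3
      exact h3.trans (add_le_add (hGR _ hyG) h2)))
    hx (m := m) (fun i hi => Set.disjoint_left.2 fun y hy hyG =>
      hGT y hyG (segment_subset_trace _ hi hy)) (by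
      intro v hvT hvG e he
      have := disjoint_segment_of_notMem hx hhole he hvT hvG
      exact ⟨this, fun h => Set.disjoint_left.1 this (right_mem_segment ℝ _ _) h⟩)
  refine ⟨K, hK, fun Ω _ P X hX n hn => (hbound Ω P X hX n hn).trans ?_⟩
  refine lintegral_mono fun ω => ENat.toENNReal_le.2 ?_
  refine Set.encard_le_encard_of_injOn (f := fun z => z₀ + z) ?_
    (fun a _ b _ h => add_left_cancel h)
  intro z hz
  rw [Set.mem_ofPred_eq] at hz
  obtain ⟨k, hk, hs⟩ := hz.exists_path_eq
  set s := path fun j => X j ω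
  rw [Set.mem_ofPred_eq, eq_translate_translate, ← hGdef]
  have hseg {a b : ℤ × ℤ} {y : ℂ}
      (hy : y + toComplex z ∈ segment ℝ (toComplex a) (toComplex b)) :
      y ∈ segment ℝ (toComplex (a - z)) (toComplex (b - z)) := by
    rw [← mem_segment_translate ℝ (toComplex z), toComplex_sub, toComplex_sub, add_sub_cancel,
      add_sub_cancel, add_comm]
    exact hy
  refine isHole_translate hhole ?_ ?_
  · intro y hy
    rcases mem_segment_or_of_mem_trace hy with ⟨i, hi, hy⟩ | rfl
    · refine segment_subset_trace s (show k + i < 2 * n by omega) ?_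
      rw [hs i hi.le, add_assoc, hs (i + 1) hi, toComplex_add, toComplex_add,
        add_comm _ (toComplex z), add_comm _ (toComplex z), add_comm _ (toComplex z),
        mem_segment_translate]
      exact hy
    · rw [← toComplex_add, ← hs _ le_rfl]
      exact toComplex_mem_trace s hk
  · intro y hy hyT
    rcases mem_segment_or_of_mem_trace hyT with ⟨i, hi, hyi⟩ | hyN
    · exact Set.disjoint_left.1 (hz.1 i hi) (hseg hyi) hy
    · have hyN' : y = toComplex (s (2 * n) - z) := by
        rw [toComplex_sub, ← hyN, add_sub_cancel_right]
      rcases Nat.eq_zero_or_pos n with rfl | hn0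
      · -- without any step, the walk is at the starting point of the translated path
        have h0 := hs 0 (Nat.zero_le _)
        rw [show k + 0 = 2 * 0 by omega] at h0
        rw [h0, add_sub_cancel_right] at hyN'
        exact hGT y hy (hyN' ▸ toComplex_mem_trace (path x) (Nat.zero_le _))
      · have := hz.1 (2 * n - 1) (by omega)
        rw [Nat.sub_add_cancel (by omega)] at this
        exact Set.disjoint_left.1 this (right_mem_segment ℝ _ _) (hyN' ▸ hy)

end PlanarHoles

theorem lemma6p1 :
    (∀ (m : ℕ) (H : Set ℂ), H ∈ PlanarHoles.holeShapes m →
      ∃ K : ℝ, 0 < K ∧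
        ∀ (Ω : Type*) [MeasurableSpace Ω] (P : Measure Ω) [IsProbabilityMeasure P]
          (X : ℕ → Ω → ℤ × ℤ), PlanarHoles.IsSRWIncrements P X →
          ∀ n : ℕ, m ≤ n →
            ENNReal.ofReal (K * (n / Real.log n ^ 2)) ≤
              ∫⁻ ω, (PlanarHoles.holeCount (PlanarHoles.path fun j => X j ω) n H : ℝ≥0∞) ∂P) ∧
    (∀ (m : ℕ) (H : Set (ℤ × ℤ)), H ∈ PlanarHoles.latticeHoleShapes m →
      ∃ K : ℝ, 0 < K ∧
        ∀ (Ω : Type*) [MeasurableSpace Ω] (P : Measure Ω) [IsProbabilityMeasure P]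
          (X : ℕ → Ω → ℤ × ℤ), PlanarHoles.IsSRWIncrements P X →
          ∀ n : ℕ, m ≤ n →
            ENNReal.ofReal (K * (n / Real.log n ^ 2)) ≤
              ∫⁻ ω, (PlanarHoles.latticeHoleCount
                (PlanarHoles.path fun j => X j ω) n H : ℝ≥0∞) ∂P) := by
  refine ⟨fun m H hH => ?_, fun m H hH => ?_⟩
  · obtain ⟨K, hK, h⟩ := PlanarHoles.exists_le_lintegral_holeCount hH
    exact ⟨K, hK, fun Ω _ P _ X hX n hn => h Ω P X hX n hn⟩
  · obtain ⟨K, hK, h⟩ := PlanarHoles.exists_le_lintegral_latticeHoleCount hH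
    exact ⟨K, hK, fun Ω _ P _ X hX n hn => h Ω P X hX n hn⟩
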